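/- Let $\mathbf C$ be a category with finite coproducts and let $\#:\mathbf C\times\mathbf C\to\mathbf C$ be a parametrized monad, i.e. a functor from $\mathbf C$ to the category of monads over $\mathbf C$ and monad morphisms, sending $X$ to the monad $(-)\#X$ with unit $u^X_A:A\to A\#X$ and multiplication $m^X_A:(A\#X)\#X\to A\#X$. For $f:Y\to A\#Y$ and $g:X\to Y\#X$ let $$f\mathbin{\blacksquare}g \;=\; m^{Y+X}_A\circ\bigl((\mathrm{id}\#\mathrm{inl})\#\mathrm{inr}\bigr)\circ(f\#\mathrm{id})\circ[u^X_Y,g]\;:\;Y+X\to A\#(Y+X).$$ A complete Elgot $\#$-algebra is an object $A$ with an algebra $a:A\#A\to A$ for the monad $(-)\#A$ (i.e. $a\circ u^A_A=\mathrm{id}$ and $a\circ(a\#\mathrm{id})=a\circ m^A_A$) and an operator assigning to every $e:X\to A\#X$ a morphism $e^\ast:X\to A$ such that * (solution) $e^\ast=a\circ(\mathrm{id}\#e^\ast)\circ e$ for all $e:X\to A\#X$; * (functoriality) for all $e:X\to A\#X$, $f:Y\to A\#Y$ and $h:X\to Y$, if $f\circ h=(\mathrm{id}\#h)\circ e$ then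 $f^\ast\circ h=e^\ast$; * (compositionality) $(f\mathbin{\blacksquare}g)^\ast\circ\mathrm{inr}=\bigl((f^\ast\#\mathrm{id})\circ g\bigr)^\ast$ for all $f:Y\to A\#Y$ and $g:X\to Y\#X$. A morphism from $(A,a,(-)^\ast)$ to $(B,b,(-)^\star)$ is a morphism $f:A\to B$ of $\mathbf C$ with $((f\#\mathrm{id})\circ e)^\star=f\circ e^\ast$ for all $e:X\to A\#X$. A complete Elgot $\#$-algebra $F$ with a morphism $\eta:A\to F$ of $\mathbf C$ is free on $A$ if every morphism of $\mathbf C$ from $A$ to (the carrier of) a complete Elgot $\#$-algebra $B$ equals $g\circ\eta$ for a unique morphism $g:F\to B$ of complete Elgot $\#$-algebras. Then: 1. A free complete Elgot $\#$-algebra exists on every object $A$ of $\mathbf C$ if and only if for every object $A$ the functor $A\#(-)$ has a final coalgebra. 2. Suppose that for every $A$ a final coalgebra $\mathrm{out}_A:F_\#A\to A\#F_\#A$ of $A\#(-)$ is given, and write $\mathrm{coit}\,c:X\to F_\#A$ for the unique coalgebra morphism from a coalgebra $c:X\to A\#X$. Then for every $A$ $$FA=\bigl(F_\#A,\ \mathrm{out}_A^{-1}\circ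 m_A^{F_\#A}\circ(\mathrm{out}_A\#\mathrm{id}),\ (-)^\dagger\bigr),\qquad e^\dagger=(\mathrm{coit}\,c_e)\circ\mathrm{inr}\quad\text{for } e:X\to F_\#A\#X,$$ where $$c_e=\mathrm{out}_A\mathbin{\blacksquare}e= m_A^{F_\#A+X}\circ\bigl((\mathrm{id}\#\mathrm{inl})\#\mathrm{inr}\bigr)\circ(\mathrm{out}_A\#\mathrm{id})\circ[u^X_{F_\#A},e]:F_\#A+X\to A\#(F_\#A+X),$$ is a complete Elgot $\#$-algebra, and it is free on $A$ with universal morphism $\mathrm{out}_A^{-1}\circ u_A^{F_\#A}$. Moreover $A\mapsto FA$ becomes a functor by sending $f:A\to B$ to $\mathrm{coit}((f\#\mathrm{id})\circ\mathrm{out}_A):F_\#A\to F_\#B$, and this functor is left adjoint to the forgetful functor from complete Elgot $\#$-algebras to $\mathbf C$, with unit $\mathrm{out}_A^{-1}\circ u_A^{F_\#A}$. -/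

import Mathlib

open CategoryTheory Limits

universe v u

namespace ElgotAlg

variable {C : Type u} [Category.{v} C]

/-! ### Parametrized monads

A parametrized monad over `C` is a functor `P : C ⥤ Monad C`; we write `A # X` for
`(P.obj X).obj A`, so that `(-) # X` is the monad `P.obj X`. -/

/-- The object `A # X`. -/
abbrev sharp (P : C ⥤ Monad C) (A X : C) : C := (P.obj X).obj A

/-- The action `f # g : A # X ⟶ B # Y` of the bifunctor `#` on morphisms. -/
def sharpMap (P : C ⥤ Monad C) {A B X Y : C} (f : A ⟶ B) (g : X ⟶ Y) :
    sharp P A X ⟶ sharp P B Y :=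
  (P.obj X).map f ≫ (P.map g).app B

/-- The unit `u_A^X : A ⟶ A # X` of the monad `(-) # X`. -/
def unit (P : C ⥤ Monad C) (A X : C) : A ⟶ sharp P A X := (P.obj X).η.app A

/-- The multiplication `m_A^X : (A # X) # X ⟶ A # X` of the monad `(-) # X`. -/
def mult (P : C ⥤ Monad C) (A X : C) : sharp P (sharp P A X) X ⟶ sharp P A X :=
  (P.obj X).μ.app A

theorem sharpMap_id (P : C ⥤ Monad C) (A X : C) : sharpMap P (𝟙 A) (𝟙 X) = 𝟙 (sharp P A X) := by
  simp [sharpMap]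

theorem sharpMap_comp (P : C ⥤ Monad C) {A B D X Y Z : C} (f : A ⟶ B) (f' : B ⟶ D)
    (g : X ⟶ Y) (g' : Y ⟶ Z) :
    sharpMap P (f ≫ f') (g ≫ g') = sharpMap P f g ≫ sharpMap P f' g' := by
  simp [sharpMap]

/-- The endofunctor `A # (-)`. -/
def sharpFunctor (P : C ⥤ Monad C) (A : C) : C ⥤ C where
  obj X := sharp P A X
  map g := sharpMap P (𝟙 A) g
  map_id X := sharpMap_id P A X
  map_comp g g' := by rw [← sharpMap_comp, Category.comp_id]

/-! ### Complete Elgot algebras -/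

/-- The morphism `f ■ g : Y + X ⟶ A # (Y + X)`, for `f : Y ⟶ A # Y` and `g : X ⟶ Y # X`, namely
`Y + X ⟶ Y # X ⟶ (A # Y) # X ⟶ (A # (Y + X)) # (Y + X) ⟶ A # (Y + X)`. -/
noncomputable def blackSquare [HasBinaryCoproducts C] (P : C ⥤ Monad C) {A X Y : C}
    (f : Y ⟶ sharp P A Y) (g : X ⟶ sharp P Y X) : Y ⨿ X ⟶ sharp P A (Y ⨿ X) :=
  coprod.desc (unit P Y X) g ≫ sharpMap P f (𝟙 X) ≫
    sharpMap P (sharpMap P (𝟙 A) (coprod.inl : Y ⟶ Y ⨿ X)) (coprod.inr : X ⟶ Y ⨿ X) ≫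
    mult P A (Y ⨿ X)

/-- An object with a morphism `A # A ⟶ A` and an operator taking `e : X ⟶ A # X` to
`iter e : X ⟶ A`, without any axioms. -/
structure IterAlg (P : C ⥤ Monad C) where
  carrier : C
  str : sharp P carrier carrier ⟶ carrier
  iter : ∀ {X : C}, (X ⟶ sharp P carrier X) → (X ⟶ carrier)

/-- The axioms of a complete Elgot `#`-algebra: the first two say that `str` is an algebra for the
monad `(-) # A`, the other three are the axioms of the iteration operator. -/
structure IterAlg.IsCompleteElgot [HasBinaryCoproducts C] {P : C ⥤ Monad C}
    (A : IterAlg P) : Prop where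
  unit_str : unit P A.carrier A.carrier ≫ A.str = 𝟙 A.carrier
  mult_str : sharpMap P A.str (𝟙 A.carrier) ≫ A.str = mult P A.carrier A.carrier ≫ A.str
  solution : ∀ {X : C} (e : X ⟶ sharp P A.carrier X),
    A.iter e = e ≫ sharpMap P (𝟙 A.carrier) (A.iter e) ≫ A.str
  functoriality : ∀ {X Y : C} (e : X ⟶ sharp P A.carrier X) (f : Y ⟶ sharp P A.carrier Y)
    (h : X ⟶ Y), h ≫ f = e ≫ sharpMap P (𝟙 A.carrier) h → h ≫ A.iter f = A.iter e
  compositionality : ∀ {X Y : C} (f : Y ⟶ sharp P A.carrier Y) (g : X ⟶ sharp P Y X),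
    (coprod.inr : X ⟶ Y ⨿ X) ≫ A.iter (blackSquare P f g) =
      A.iter (g ≫ sharpMap P (A.iter f) (𝟙 X))

/-- A morphism of the carriers preserves iteration. -/
def IsElgotHom {P : C ⥤ Monad C} (A B : IterAlg P) (f : A.carrier ⟶ B.carrier) : Prop :=
  ∀ {X : C} (e : X ⟶ sharp P A.carrier X), B.iter (e ≫ sharpMap P f (𝟙 X)) = A.iter e ≫ f

/-- Complete Elgot `#`-algebras. -/
structure CompleteElgotAlg [HasBinaryCoproducts C] (P : C ⥤ Monad C) extends IterAlg P where
  isCompleteElgot : toIterAlg.IsCompleteElgot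

/-- Morphisms of complete Elgot `#`-algebras: iteration preserving morphisms. -/
@[ext]
structure CompleteElgotAlg.Hom [HasBinaryCoproducts C] {P : C ⥤ Monad C}
    (A B : CompleteElgotAlg P) where
  hom : A.carrier ⟶ B.carrier
  isElgotHom : IsElgotHom A.toIterAlg B.toIterAlg hom

/-- The category of complete Elgot `#`-algebras. -/
instance [HasBinaryCoproducts C] (P : C ⥤ Monad C) : Category.{v} (CompleteElgotAlg P) where
  Hom A B := CompleteElgotAlg.Hom A B
  id A := ⟨𝟙 A.carrier, fun e => by rw [sharpMap_id]; simp⟩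
  comp {A B D} f g := ⟨f.hom ≫ g.hom, fun {X} e => by
    have h := sharpMap_comp P f.hom g.hom (𝟙 X) (𝟙 X)
    rw [Category.comp_id] at h
    rw [h, ← Category.assoc, g.isElgotHom, f.isElgotHom, Category.assoc]⟩
  id_comp _ := CompleteElgotAlg.Hom.ext (Category.id_comp _)
  comp_id _ := CompleteElgotAlg.Hom.ext (Category.comp_id _)
  assoc _ _ _ := CompleteElgotAlg.Hom.ext (Category.assoc _ _ _)

/-- The forgetful functor from complete Elgot `#`-algebras to `C`. -/
def forget [HasBinaryCoproducts C] (P : C ⥤ Monad C) : CompleteElgotAlg P ⥤ C where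
  obj A := A.carrier
  map f := f.hom
  map_id _ := rfl
  map_comp _ _ := rfl

/-- `F` is a free complete Elgot `#`-algebra on `A` with universal morphism `η`. -/
def IsFreeOn [HasBinaryCoproducts C] {P : C ⥤ Monad C} {A : C} (F : CompleteElgotAlg P)
    (η : A ⟶ F.carrier) : Prop :=
  ∀ (B : CompleteElgotAlg P) (f : A ⟶ B.carrier), ∃! g : F ⟶ B, η ≫ (forget P).map g = f

/-! ### Final coalgebras of `A # (-)`

Below `nu` is a coalgebra for `A # (-)`, its structure morphism `nu.str` is `out`, and
`h : IsTerminal nu` says that it is final. -/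

/-- The unique coalgebra morphism `coit c` from `(X, c)` to the final coalgebra. -/
def coit {P : C ⥤ Monad C} {A : C} {nu : Endofunctor.Coalgebra (sharpFunctor P A)}
    (h : IsTerminal nu) {X : C} (c : X ⟶ sharp P A X) : X ⟶ nu.V :=
  (h.from (⟨X, c⟩ : Endofunctor.Coalgebra (sharpFunctor P A))).f

/-- The structure morphism of a coalgebra for `A # (-)`, with its type written as `A # V`. -/
def out {P : C ⥤ Monad C} {A : C} (nu : Endofunctor.Coalgebra (sharpFunctor P A)) :
    nu.V ⟶ sharp P A nu.V :=
  nu.str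

/-- The inverse of `out` for a final coalgebra. -/
def outInv {P : C ⥤ Monad C} {A : C} {nu : Endofunctor.Coalgebra (sharpFunctor P A)}
    (h : IsTerminal nu) : sharp P A nu.V ⟶ nu.V :=
  coit h (sharpMap P (𝟙 A) (out nu))

/-- The identities that make `outInv` the inverse of `out`. -/
theorem out_outInv {P : C ⥤ Monad C} {A : C} {nu : Endofunctor.Coalgebra (sharpFunctor P A)}
    (h : IsTerminal nu) : out nu ≫ outInv h = 𝟙 _ ∧ outInv h ≫ out nu = 𝟙 _ :=
  ⟨Endofunctor.Coalgebra.Terminal.right_inv h, Endofunctor.Coalgebra.Terminal.left_inv h⟩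

theorem coit_out {P : C ⥤ Monad C} {A : C} {nu : Endofunctor.Coalgebra (sharpFunctor P A)}
    (h : IsTerminal nu) {X : C} (c : X ⟶ sharp P A X) :
    c ≫ sharpMap P (𝟙 A) (coit h c) = coit h c ≫ out nu :=
  (h.from (⟨X, c⟩ : Endofunctor.Coalgebra (sharpFunctor P A))).h

theorem coit_unique {P : C ⥤ Monad C} {A : C} {nu : Endofunctor.Coalgebra (sharpFunctor P A)}
    (h : IsTerminal nu) {X : C} (c : X ⟶ sharp P A X) (k : X ⟶ nu.V)
    (hk : c ≫ sharpMap P (𝟙 A) k = k ≫ out nu) : k = coit h c :=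
  congrArg Endofunctor.Coalgebra.Hom.f (h.hom_ext
    (⟨k, hk⟩ : (⟨X, c⟩ : Endofunctor.Coalgebra (sharpFunctor P A)) ⟶ nu)
    (h.from (⟨X, c⟩ : Endofunctor.Coalgebra (sharpFunctor P A))))

/-- The final coalgebra of `A # (-)` with the morphism `out⁻¹ ∘ m ∘ (out # id)` and the iteration
taking `e` to `coit c ∘ inr`, where `c = m ∘ ((id # inl) # inr) ∘ (out # id) ∘ [u, e]`. -/
noncomputable def freeData [HasBinaryCoproducts C] {P : C ⥤ Monad C} {A : C}
    {nu : Endofunctor.Coalgebra (sharpFunctor P A)} (h : IsTerminal nu) : IterAlg P where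
  carrier := nu.V
  str := sharpMap P (out nu) (𝟙 nu.V) ≫ mult P A nu.V ≫ outInv h
  iter {X} e := (coprod.inr : X ⟶ nu.V ⨿ X) ≫ coit h (blackSquare P (out nu) e)

/-- The morphism `out⁻¹ ∘ u` from `A` to the final coalgebra of `A # (-)`. -/
def freeUnit {P : C ⥤ Monad C} {A : C} {nu : Endofunctor.Coalgebra (sharpFunctor P A)}
    (h : IsTerminal nu) : A ⟶ nu.V :=
  unit P A nu.V ≫ outInv h

/-- The action of `A ↦ νγ. A # γ` on morphisms: `f` is taken to `coit ((f # id) ∘ out)`. -/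
def nuMap {P : C ⥤ Monad C} {A B : C} (nuA : Endofunctor.Coalgebra (sharpFunctor P A))
    {nuB : Endofunctor.Coalgebra (sharpFunctor P B)} (hB : IsTerminal nuB) (f : A ⟶ B) :
    nuA.V ⟶ nuB.V :=
  coit hB (out nuA ≫ sharpMap P f (𝟙 nuA.V))

theorem nuMap_id {P : C ⥤ Monad C} {A : C} {nu : Endofunctor.Coalgebra (sharpFunctor P A)}
    (h : IsTerminal nu) : nuMap nu h (𝟙 A) = 𝟙 nu.V := by
  symm
  apply coit_unique
  simp only [sharpMap_id, Category.comp_id, Category.id_comp]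

theorem nuMap_comp {P : C ⥤ Monad C} {A B D : C}
    (nuA : Endofunctor.Coalgebra (sharpFunctor P A))
    {nuB : Endofunctor.Coalgebra (sharpFunctor P B)} (hB : IsTerminal nuB)
    {nuD : Endofunctor.Coalgebra (sharpFunctor P D)} (hD : IsTerminal nuD)
    (f : A ⟶ B) (g : B ⟶ D) :
    nuMap nuA hD (f ≫ g) = nuMap nuA hB f ≫ nuMap nuB hD g := by
  symm
  apply coit_unique
  have h1 : out nuA ≫ sharpMap P f (nuMap nuA hB f) = nuMap nuA hB f ≫ out nuB := by
    have := coit_out hB (out nuA ≫ sharpMap P f (𝟙 nuA.V))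
    rwa [Category.assoc, ← sharpMap_comp, Category.comp_id, Category.id_comp] at this
  have h2 : out nuB ≫ sharpMap P g (nuMap nuB hD g) = nuMap nuB hD g ≫ out nuD := by
    have := coit_out hD (out nuB ≫ sharpMap P g (𝟙 nuB.V))
    rwa [Category.assoc, ← sharpMap_comp, Category.comp_id, Category.id_comp] at this
  rw [Category.assoc, ← sharpMap_comp, Category.comp_id, Category.id_comp, sharpMap_comp,
    ← Category.assoc, h1, Category.assoc, h2, Category.assoc]

/-- The functor taking `A` to the final coalgebra of `A # (-)` with its algebra structure and
iteration, given that these satisfy the axioms and that the morphisms `nuMap` preserve them. -/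
noncomputable def freeFunctor [HasBinaryCoproducts C] (P : C ⥤ Monad C)
    (nu : ∀ A : C, Endofunctor.Coalgebra (sharpFunctor P A)) (hnu : ∀ A : C, IsTerminal (nu A))
    (hE : ∀ A : C, (freeData (hnu A)).IsCompleteElgot)
    (hM : ∀ (A B : C) (f : A ⟶ B),
      IsElgotHom (freeData (hnu A)) (freeData (hnu B)) (nuMap (nu A) (hnu B) f)) :
    C ⥤ CompleteElgotAlg P where
  obj A := ⟨freeData (hnu A), hE A⟩
  map {A B} f := ⟨nuMap (nu A) (hnu B) f, hM A B f⟩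
  map_id A := CompleteElgotAlg.Hom.ext (nuMap_id (hnu A))
  map_comp {A B D} f g := CompleteElgotAlg.Hom.ext (nuMap_comp (nu A) (hnu B) (hnu D) f g)

end ElgotAlg

/-! In a final coalgebra `out` is invertible. Composing the solution equation for `e` with it shows
that `k` is a solution exactly when `[𝟙, k]` is a coalgebra morphism from `out ■ e` to `out`. So
solutions are unique (`eq_nuIter_iff`), and uniqueness alone yields functoriality and
compositionality (`isCompleteElgot_of_unique`). A morphism `f : A ⟶ B` extends to the iterate in `B`
of `out ≫ (f # 𝟙)`, which preserves iteration by functoriality and compositionality in `B`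
(`isElgotHom_iter`). The extension is unique because `𝟙` is itself an iterate (`nuIter_freeUnit`).

The converse is a Lambek-type argument. If `F` is free on `A`, then `A # F` is again a complete
Elgot algebra, and the extension `o : F ⟶ A # F` of the unit is inverse to `tau`. Iteration in `F`
gives coalgebra morphisms into `(F, o)`. They are unique by functoriality, since the iterate of `o ≫
(η # 𝟙)` is an endomorphism fixing `η`, hence the identity. -/

namespace ElgotAlg

/-! ### Calculus of `#` and of `f ■ g` -/

section Sharp

variable {C : Type u} [Category.{v} C] (P : C ⥤ Monad C)

theorem sharpMap_sharpMap {A B D X Y Z : C} (f : A ⟶ B) (f' : B ⟶ D) (g : X ⟶ Y) (g' : Y ⟶ Z) :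
    sharpMap P f g ≫ sharpMap P f' g' = sharpMap P (f ≫ f') (g ≫ g') :=
  (sharpMap_comp P f f' g g').symm

theorem sharpMap_sharpMap_assoc {A B D X Y Z W : C} (f : A ⟶ B) (f' : B ⟶ D) (g : X ⟶ Y)
    (g' : Y ⟶ Z) (k : sharp P D Z ⟶ W) :
    sharpMap P f g ≫ sharpMap P f' g' ≫ k = sharpMap P (f ≫ f') (g ≫ g') ≫ k :=
  (reassoc_of% sharpMap_sharpMap P f f' g g') k

theorem unit_sharpMap {A B X Y : C} (f : A ⟶ B) (g : X ⟶ Y) :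
    unit P A X ≫ sharpMap P f g = f ≫ unit P B Y := by
  have h := (P.obj Y).η.naturality f
  simp only [Functor.id_obj, Functor.id_map] at h
  simp [unit, sharpMap, h]

theorem unit_sharpMap_assoc {A B X Y W : C} (f : A ⟶ B) (g : X ⟶ Y) (k : sharp P B Y ⟶ W) :
    unit P A X ≫ sharpMap P f g ≫ k = f ≫ unit P B Y ≫ k :=
  (reassoc_of% unit_sharpMap P f g) k

theorem mult_sharpMap {A B X Y : C} (f : A ⟶ B) (g : X ⟶ Y) :
    mult P A X ≫ sharpMap P f g = sharpMap P (sharpMap P f g) g ≫ mult P B Y := by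
  have h := (P.obj Y).μ.naturality f
  simp only [Functor.comp_obj, Functor.comp_map] at h
  simp only [sharp, mult, sharpMap, NatTrans.naturality, MonadHom.app_μ_assoc,
    Functor.map_comp, Category.assoc, ← h, NatTrans.naturality_assoc]

theorem mult_sharpMap_assoc {A B X Y W : C} (f : A ⟶ B) (g : X ⟶ Y) (k : sharp P B Y ⟶ W) :
    mult P A X ≫ sharpMap P f g ≫ k = sharpMap P (sharpMap P f g) g ≫ mult P B Y ≫ k :=
  (reassoc_of% mult_sharpMap P f g) k

theorem unit_mult (A X : C) : unit P (sharp P A X) X ≫ mult P A X = 𝟙 _ :=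
  (P.obj X).left_unit A

theorem sharpMap_unit_mult {A B X Y : C} (f : A ⟶ B) (g : X ⟶ Y) :
    sharpMap P (f ≫ unit P B Y) g ≫ mult P B Y = sharpMap P f g := by
  have h : sharpMap P (unit P B Y) (𝟙 Y) ≫ mult P B Y = 𝟙 _ := by
    simp [sharpMap, unit, mult]
  rw [← Category.comp_id (sharpMap P f g), ← h, sharpMap_sharpMap_assoc, Category.comp_id]

theorem mult_mult (A X : C) :
    mult P (sharp P A X) X ≫ mult P A X = sharpMap P (mult P A X) (𝟙 X) ≫ mult P A X := by
  have h := (P.obj X).assoc A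
  simp [sharpMap, mult, h]

variable [HasBinaryCoproducts C]

theorem inl_blackSquare {A X Y : C} (f : Y ⟶ sharp P A Y) (g : X ⟶ sharp P Y X) :
    (coprod.inl : Y ⟶ Y ⨿ X) ≫ blackSquare P f g = f ≫ sharpMap P (𝟙 A) coprod.inl := by
  rw [blackSquare, coprod.inl_desc_assoc]
  simp [unit_sharpMap_assoc, unit_mult]

theorem inl_blackSquare_assoc {A X Y W : C} (f : Y ⟶ sharp P A Y) (g : X ⟶ sharp P Y X)
    (k : sharp P A (Y ⨿ X) ⟶ W) : (coprod.inl : Y ⟶ Y ⨿ X) ≫ blackSquare P f g ≫ k =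
      f ≫ sharpMap P (𝟙 A) coprod.inl ≫ k :=
  (reassoc_of% inl_blackSquare P f g) k

theorem inr_blackSquare {A X Y : C} (f : Y ⟶ sharp P A Y) (g : X ⟶ sharp P Y X) :
    (coprod.inr : X ⟶ Y ⨿ X) ≫ blackSquare P f g =
      g ≫ sharpMap P (f ≫ sharpMap P (𝟙 A) coprod.inl) coprod.inr ≫ mult P A (Y ⨿ X) := by
  rw [blackSquare, coprod.inr_desc_assoc]
  simp [sharpMap_sharpMap_assoc]

theorem inr_blackSquare_assoc {A X Y W : C} (f : Y ⟶ sharp P A Y) (g : X ⟶ sharp P Y X)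
    (k : sharp P A (Y ⨿ X) ⟶ W) : (coprod.inr : X ⟶ Y ⨿ X) ≫ blackSquare P f g ≫ k =
      g ≫ sharpMap P (f ≫ sharpMap P (𝟙 A) coprod.inl) coprod.inr ≫ mult P A (Y ⨿ X) ≫ k :=
  (reassoc_of% inr_blackSquare P f g) k

/-- The morphism `f ■ g` followed by `k # l`, on the second summand. -/
theorem inr_blackSquare_sharpMap {A B X Y Z : C} (f : Y ⟶ sharp P A Y) (g : X ⟶ sharp P Y X)
    (k : A ⟶ B) (l : Y ⨿ X ⟶ Z) :
    (coprod.inr : X ⟶ Y ⨿ X) ≫ blackSquare P f g ≫ sharpMap P k l =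
      g ≫ sharpMap P (f ≫ sharpMap P k (coprod.inl ≫ l)) (coprod.inr ≫ l) ≫ mult P B Z := by
  simp [inr_blackSquare_assoc, mult_sharpMap, sharpMap_sharpMap, sharpMap_sharpMap_assoc]

theorem blackSquare_sharpMap {A B X Y : C} (f : Y ⟶ sharp P A Y) (g : X ⟶ sharp P Y X)
    (k : A ⟶ B) :
    blackSquare P (f ≫ sharpMap P k (𝟙 Y)) g = blackSquare P f g ≫ sharpMap P k (𝟙 _) := by
  apply coprod.hom_ext
  · simp [inl_blackSquare, inl_blackSquare_assoc, sharpMap_sharpMap]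
  · rw [inr_blackSquare_sharpMap]
    simp [inr_blackSquare, sharpMap_sharpMap]

/-- The two hypotheses are the coalgebra morphism condition on each summand of `f ■ g`. With `l = 𝟙`
this translates substitution equations for `r` into coalgebra morphisms out of `f ■ g`. -/
theorem desc_comp_eq_blackSquare_comp {A X Y Z : C} (f : Y ⟶ sharp P A Y) (g : X ⟶ sharp P Y X)
    (l : Y ⟶ Z) (r : X ⟶ Z) (d : Z ⟶ sharp P A Z)
    (hl : l ≫ d = f ≫ sharpMap P (𝟙 A) l) (hr : r ≫ d = g ≫ sharpMap P (l ≫ d) r ≫ mult P A Z) :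
    coprod.desc l r ≫ d = blackSquare P f g ≫ sharpMap P (𝟙 A) (coprod.desc l r) := by
  apply coprod.hom_ext
  · rw [coprod.inl_desc_assoc, inl_blackSquare_assoc, sharpMap_sharpMap, coprod.inl_desc,
      Category.comp_id, hl]
  · rw [coprod.inr_desc_assoc, inr_blackSquare_sharpMap, coprod.inl_desc, coprod.inr_desc, ← hl, hr]

end Sharp

/-! ### Iteration-preserving morphisms and unique solutions -/

section ElgotHom

variable {C : Type u} [Category.{v} C] [HasBinaryCoproducts C] {P : C ⥤ Monad C}

/-- An iteration preserving morphism is a morphism of the algebra structures. -/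
theorem IsElgotHom.str_comp {A B : IterAlg P} (hA : A.IsCompleteElgot) (hB : B.IsCompleteElgot)
    {f : A.carrier ⟶ B.carrier} (hf : IsElgotHom A B f) :
    A.str ≫ f = sharpMap P f f ≫ B.str := by
  -- This equation encodes `str` as an iterate: the right summand returns its argument at once, by
  -- the unit law, and the left one then evaluates to `str`.
  let e : sharp P A.carrier A.carrier ⨿ A.carrier ⟶
      sharp P A.carrier (sharp P A.carrier A.carrier ⨿ A.carrier) :=
    coprod.desc (sharpMap P (𝟙 _) coprod.inr) (unit P _ _)
  have el : coprod.inl ≫ e = sharpMap P (𝟙 _) coprod.inr := coprod.inl_desc _ _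
  have er : coprod.inr ≫ e = unit P _ _ := coprod.inr_desc _ _
  have hAr : coprod.inr ≫ A.iter e = 𝟙 _ := by
    rw [hA.solution, reassoc_of% er, unit_sharpMap_assoc, hA.unit_str, Category.comp_id]
  have hAl : coprod.inl ≫ A.iter e = A.str := by
    rw [hA.solution, reassoc_of% el, sharpMap_sharpMap_assoc, hAr, Category.comp_id, sharpMap_id,
      Category.id_comp]
  have hBr : coprod.inr ≫ B.iter (e ≫ sharpMap P f (𝟙 _)) = f := by
    rw [hB.solution, Category.assoc, reassoc_of% er, unit_sharpMap_assoc, unit_sharpMap_assoc,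
      hB.unit_str, Category.id_comp, Category.comp_id]
  have hBl : coprod.inl ≫ B.iter (e ≫ sharpMap P f (𝟙 _)) = sharpMap P f f ≫ B.str := by
    rw [hB.solution, Category.assoc, reassoc_of% el, sharpMap_sharpMap_assoc,
      sharpMap_sharpMap_assoc, Category.id_comp, Category.comp_id, Category.comp_id, hBr]
  rw [← hBl, hf, ← hAl, Category.assoc]

theorem IterAlg.IsCompleteElgot.inl_iter {B : IterAlg P} (hB : B.IsCompleteElgot) {X Y : C}
    (f : Y ⟶ sharp P B.carrier Y) (g : X ⟶ sharp P Y X) :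
    coprod.inl ≫ B.iter (blackSquare P f g) = B.iter f :=
  hB.functoriality _ _ _ (inl_blackSquare P f g)

/-- A coalgebra on which iteration can be computed by substitution gives rise to
iteration preserving morphisms. -/
theorem isElgotHom_iter {A B : IterAlg P} (hB : B.IsCompleteElgot)
    (d : A.carrier ⟶ sharp P B.carrier A.carrier)
    (hd : ∀ {X : C} (e : X ⟶ sharp P A.carrier X),
      A.iter e ≫ d = e ≫ sharpMap P d (A.iter e) ≫ mult P _ _) :
    IsElgotHom A B (B.iter d) := by
  intro X e
  -- By `hd`, `[𝟙, A.iter e]` is a coalgebra morphism from `d ■ e` to `d`; compositionality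
  -- identifies the iterate of `d ■ e` on the right summand.
  have h := hB.functoriality (blackSquare P d e) d (coprod.desc (𝟙 _) (A.iter e))
    (desc_comp_eq_blackSquare_comp P _ _ _ _ _ (by simp [sharpMap_id]) (by simpa using hd e))
  rw [← hB.compositionality, ← h, coprod.inr_desc_assoc]

/-- An algebra with unique solutions is a complete Elgot algebra. -/
theorem isCompleteElgot_of_unique {A : IterAlg P}
    (unit_str : unit P A.carrier A.carrier ≫ A.str = 𝟙 A.carrier)
    (mult_str : sharpMap P A.str (𝟙 A.carrier) ≫ A.str = mult P A.carrier A.carrier ≫ A.str)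
    (solution : ∀ {X : C} (e : X ⟶ sharp P A.carrier X),
      A.iter e = e ≫ sharpMap P (𝟙 A.carrier) (A.iter e) ≫ A.str)
    (unique : ∀ {X : C} (e : X ⟶ sharp P A.carrier X) (k : X ⟶ A.carrier),
      k = e ≫ sharpMap P (𝟙 A.carrier) k ≫ A.str → k = A.iter e) :
    A.IsCompleteElgot := by
  have functoriality {X Y : C} (e : X ⟶ sharp P A.carrier X) (f : Y ⟶ sharp P A.carrier Y)
      (h : X ⟶ Y) (hh : h ≫ f = e ≫ sharpMap P (𝟙 A.carrier) h) : h ≫ A.iter f = A.iter e := by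
    apply unique
    conv_lhs => rw [solution]
    rw [reassoc_of% hh, sharpMap_sharpMap_assoc, Category.comp_id]
  refine ⟨unit_str, mult_str, solution, functoriality, fun f g => unique _ _ ?_⟩
  -- On the left summand the iterate of `f ■ g` is `A.iter f`. Unfolding once on the right,
  -- `mult_str` turns the multiplication into the solution equation of `f` inside `g`.
  have hl := functoriality _ _ _ (inl_blackSquare P f g)
  conv_lhs => rw [solution]
  rw [← Category.assoc (blackSquare P f g), ← Category.assoc, inr_blackSquare_sharpMap, hl,
    Category.assoc, Category.assoc, ← mult_str, sharpMap_sharpMap_assoc, Category.assoc,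
    ← solution, Category.comp_id, Category.assoc, sharpMap_sharpMap_assoc, Category.comp_id,
    Category.id_comp]

end ElgotHom

/-! ### Structure maps of a final coalgebra, seen through `out` -/

section Coalgebra

variable {C : Type u} [Category.{v} C] {P : C ⥤ Monad C} {A : C}
  {nu : Endofunctor.Coalgebra (sharpFunctor P A)} (h : IsTerminal nu)

/-- The algebra structure of `freeData`, with its type written in terms of the coalgebra. -/
def nuStr : sharp P nu.V nu.V ⟶ nu.V :=
  sharpMap P (out nu) (𝟙 nu.V) ≫ mult P A nu.V ≫ outInv h

theorem nuStr_out : nuStr h ≫ out nu = sharpMap P (out nu) (𝟙 nu.V) ≫ mult P A nu.V := by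
  simp [nuStr, (out_outInv h).2]

include h in
theorem hom_ext_out {X : C} {k l : X ⟶ nu.V} (hkl : k ≫ out nu = l ≫ out nu) : k = l := by
  simpa [(out_outInv h).1] using congrArg (· ≫ outInv h) hkl

theorem sharpMap_nuStr_out {B X : C} (f : B ⟶ nu.V) (k : X ⟶ nu.V) :
    sharpMap P f k ≫ nuStr h ≫ out nu = sharpMap P (f ≫ out nu) k ≫ mult P A nu.V := by
  rw [nuStr_out, sharpMap_sharpMap_assoc, Category.comp_id]

theorem freeUnit_out : freeUnit h ≫ out nu = unit P A nu.V := by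
  simp [freeUnit, (out_outInv h).2]

theorem nuMap_out {B : C} {nuB : Endofunctor.Coalgebra (sharpFunctor P B)} (hB : IsTerminal nuB)
    (f : A ⟶ B) : nuMap nu hB f ≫ out nuB = out nu ≫ sharpMap P f (nuMap nu hB f) := by
  rw [nuMap, ← coit_out, Category.assoc, sharpMap_sharpMap, Category.comp_id, Category.id_comp]

end Coalgebra

/-! ### The free algebra on a final coalgebra -/

section Final

variable {C : Type u} [Category.{v} C] [HasBinaryCoproducts C] {P : C ⥤ Monad C} {A : C}
  {nu : Endofunctor.Coalgebra (sharpFunctor P A)} (h : IsTerminal nu)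

/-- The iteration of `freeData`, with its type written in terms of the coalgebra. -/
noncomputable def nuIter {X : C} (e : X ⟶ sharp P nu.V X) : X ⟶ nu.V :=
  (coprod.inr : X ⟶ nu.V ⨿ X) ≫ coit h (blackSquare P (out nu) e)

/-- The composite is a coalgebra endomorphism of the final coalgebra. -/
theorem inl_coit {X : C} (e : X ⟶ sharp P nu.V X) :
    coprod.inl ≫ coit h (blackSquare P (out nu) e) = 𝟙 nu.V := by
  have key : ∀ k : nu.V ⟶ nu.V, out nu ≫ sharpMap P (𝟙 A) k = k ≫ out nu → k = 𝟙 _ := by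
    intro k hk
    rw [coit_unique h _ k hk]
    exact (coit_unique h _ _ (by simp [sharpMap_id])).symm
  apply key
  rw [Category.assoc, ← coit_out, inl_blackSquare_assoc, sharpMap_sharpMap, Category.comp_id]

theorem nuIter_out {X : C} (e : X ⟶ sharp P nu.V X) :
    nuIter h e ≫ out nu = e ≫ sharpMap P (out nu) (nuIter h e) ≫ mult P A nu.V := by
  rw [nuIter, Category.assoc, ← coit_out, inr_blackSquare_sharpMap, inl_coit, sharpMap_id,
    Category.comp_id]

/-- Solutions in the final coalgebra are unique. -/
theorem eq_nuIter_iff {X : C} (e : X ⟶ sharp P nu.V X) (k : X ⟶ nu.V) :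
    k = nuIter h e ↔ k = e ≫ sharpMap P (𝟙 nu.V) k ≫ nuStr h := by
  have key : k = e ≫ sharpMap P (𝟙 nu.V) k ≫ nuStr h ↔
      k ≫ out nu = e ≫ sharpMap P (out nu) k ≫ mult P A nu.V := by
    have := sharpMap_nuStr_out h (𝟙 nu.V) k
    rw [Category.id_comp] at this
    rw [← this]
    exact ⟨fun hk => by simpa only [Category.assoc] using congrArg (· ≫ out nu) hk,
      fun hk => hom_ext_out h (by simpa only [Category.assoc] using hk)⟩
  rw [key]
  refine ⟨?_, fun hk => ?_⟩
  · rintro rfl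
    exact nuIter_out h e
  -- By finality, the coalgebra morphism `[𝟙, k]` is `coit (out ■ e)`.
  · rw [nuIter, ← coit_unique h (blackSquare P (out nu) e) (coprod.desc (𝟙 _) k),
      coprod.inr_desc]
    exact (desc_comp_eq_blackSquare_comp P _ _ _ _ _ (by simp [sharpMap_id])
      (by simpa using hk)).symm

theorem freeData_isCompleteElgot : (freeData h).IsCompleteElgot := by
  apply isCompleteElgot_of_unique (A := ⟨nu.V, nuStr h, fun e => nuIter h e⟩)
  · apply hom_ext_out h
    dsimp only
    rw [Category.assoc, nuStr_out, unit_sharpMap_assoc, unit_mult]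
    simp
  · apply hom_ext_out h
    dsimp only
    rw [Category.assoc, Category.assoc, sharpMap_nuStr_out, nuStr_out, mult_sharpMap_assoc,
      mult_mult, sharpMap_sharpMap_assoc, Category.comp_id]
  · exact fun e => (eq_nuIter_iff h e _).1 rfl
  · exact fun e k => (eq_nuIter_iff h e k).2

/-- The morphism to a complete Elgot algebra `B` that extends `f`. -/
theorem isElgotHom_freeData {B : IterAlg P} (hB : B.IsCompleteElgot) (f : A ⟶ B.carrier) :
    IsElgotHom (freeData h) B (B.iter (out nu ≫ sharpMap P f (𝟙 nu.V))) := by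
  apply isElgotHom_iter (A := ⟨nu.V, nuStr h, fun e => nuIter h e⟩) hB
  intro X e
  -- The equation `nuIter_out` is stable under postcomposition with `f # 𝟙`, by naturality of the
  -- multiplication.
  have key : nuIter h e ≫ out nu ≫ sharpMap P f (𝟙 nu.V) =
      e ≫ sharpMap P (out nu ≫ sharpMap P f (𝟙 nu.V)) (nuIter h e) ≫ mult P B.carrier nu.V := by
    rw [← Category.assoc, nuIter_out]
    simp [mult_sharpMap, sharpMap_sharpMap_assoc]
  exact key

theorem freeUnit_iter {B : IterAlg P} (hB : B.IsCompleteElgot) (f : A ⟶ B.carrier) :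
    freeUnit h ≫ B.iter (out nu ≫ sharpMap P f (𝟙 nu.V)) = f := by
  rw [hB.solution, freeUnit]
  simp [reassoc_of% (out_outInv h).2, sharpMap_sharpMap_assoc, unit_sharpMap_assoc, hB.unit_str]

/-- Seen through `out`, the inserted unit cancels against the multiplication, so the identity is a
solution. Hence an iteration-preserving morphism is determined by its composite with `freeUnit`. -/
theorem nuIter_freeUnit : nuIter h (out nu ≫ sharpMap P (freeUnit h) (𝟙 nu.V)) = 𝟙 nu.V := by
  symm
  rw [eq_nuIter_iff]
  apply hom_ext_out h
  have := sharpMap_unit_mult P (𝟙 A) (𝟙 nu.V)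
  rw [Category.id_comp] at this
  simp only [Category.assoc, sharpMap_nuStr_out, Category.comp_id,
    freeUnit_out, this, sharpMap_id, Category.id_comp]

theorem freeData_isFreeOn :
    IsFreeOn (⟨freeData h, freeData_isCompleteElgot h⟩ : CompleteElgotAlg P) (freeUnit h) := by
  intro B f
  refine ⟨⟨_, isElgotHom_freeData h B.isCompleteElgot f⟩,
    freeUnit_iter h B.isCompleteElgot f, fun g hg => CompleteElgotAlg.Hom.ext ?_⟩
  have key : ∀ k : nu.V ⟶ B.carrier, IsElgotHom (freeData h) B.toIterAlg k →
      freeUnit h ≫ k = f → k = B.iter (out nu ≫ sharpMap P f (𝟙 nu.V)) := by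
    intro k hk hf
    have h1 : B.iter ((out nu ≫ sharpMap P (freeUnit h) (𝟙 nu.V)) ≫ sharpMap P k (𝟙 nu.V)) =
      nuIter h (out nu ≫ sharpMap P (freeUnit h) (𝟙 nu.V)) ≫ k := hk _
    rw [nuIter_freeUnit, Category.id_comp, Category.assoc, sharpMap_sharpMap, hf,
      Category.comp_id] at h1
    exact h1.symm
  exact key g.hom g.isElgotHom hg

/-- Uniqueness of solutions identifies `nuMap` with the extension of `f ≫ freeUnit hB`, so its
preservation of iteration and the naturality of the unit come from the universal property. -/
theorem nuMap_eq_nuIter {B : C} {nuB : Endofunctor.Coalgebra (sharpFunctor P B)}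
    (hB : IsTerminal nuB) (f : A ⟶ B) :
    nuMap nu hB f = nuIter hB (out nu ≫ sharpMap P (f ≫ freeUnit hB) (𝟙 nu.V)) := by
  rw [eq_nuIter_iff]
  apply hom_ext_out hB
  simp only [Category.assoc, sharpMap_sharpMap_assoc, sharpMap_nuStr_out, Category.comp_id,
    Category.id_comp, freeUnit_out, sharpMap_unit_mult, nuMap_out]

theorem nuMap_isElgotHom {B : C} {nuB : Endofunctor.Coalgebra (sharpFunctor P B)}
    (hB : IsTerminal nuB) (f : A ⟶ B) :
    IsElgotHom (freeData h) (freeData hB) (nuMap nu hB f) := by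
  rw [nuMap_eq_nuIter]
  exact isElgotHom_freeData h (freeData_isCompleteElgot hB) (f ≫ freeUnit hB)

theorem freeUnit_nuMap {B : C} {nuB : Endofunctor.Coalgebra (sharpFunctor P B)}
    (hB : IsTerminal nuB) (f : A ⟶ B) :
    freeUnit h ≫ nuMap nu hB f = f ≫ freeUnit hB := by
  rw [nuMap_eq_nuIter]
  exact freeUnit_iter h (freeData_isCompleteElgot hB) (f ≫ freeUnit hB)

end Final

/-! ### The adjunction with the forgetful functor -/

section Adjunction

variable {C : Type u} [Category.{v} C] [HasBinaryCoproducts C] (P : C ⥤ Monad C)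
  (nu : ∀ A : C, Endofunctor.Coalgebra (sharpFunctor P A)) (hnu : ∀ A : C, IsTerminal (nu A))

/-- The adjunction between final coalgebras and the forgetful functor. -/
noncomputable def freeAdjunction
    (hE : ∀ A : C, (freeData (hnu A)).IsCompleteElgot)
    (hM : ∀ (A B : C) (f : A ⟶ B),
      IsElgotHom (freeData (hnu A)) (freeData (hnu B)) (nuMap (nu A) (hnu B) f)) :
    freeFunctor P nu hnu hE hM ⊣ forget P :=
  Adjunction.mkOfHomEquiv
    { homEquiv := fun A B => Equiv.ofBijective
        (fun g : (freeFunctor P nu hnu hE hM).obj A ⟶ B => freeUnit (hnu A) ≫ (forget P).map g)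
        ((Function.bijective_iff_existsUnique _).2 fun f => freeData_isFreeOn (hnu A) B f)
      homEquiv_naturality_left_symm := fun {A A' B} f g => by
        rw [Equiv.symm_apply_eq]
        -- Writing `g` as the transpose of some `k` reduces the claim to naturality of the unit,
        -- `freeUnit_nuMap`.
        obtain ⟨k, rfl⟩ := (Equiv.ofBijective _ ((Function.bijective_iff_existsUnique _).2
          fun f => freeData_isFreeOn (hnu A') B f)).surjective g
        erw [Equiv.symm_apply_apply]
        have := freeUnit_nuMap (hnu A) (hnu A') f
        change f ≫ freeUnit (hnu A') ≫ k.hom =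
          freeUnit (hnu A) ≫ nuMap (nu A) (hnu A') f ≫ k.hom
        erw [reassoc_of% this]
      homEquiv_naturality_right := fun {A B B'} f g => by
        simp only [Equiv.ofBijective_apply, Functor.map_comp]
        exact (Category.assoc _ _ _).symm }

theorem freeAdjunction_unit
    (hE : ∀ A : C, (freeData (hnu A)).IsCompleteElgot)
    (hM : ∀ (A B : C) (f : A ⟶ B),
      IsElgotHom (freeData (hnu A)) (freeData (hnu B)) (nuMap (nu A) (hnu B) f)) (A : C) :
    (freeAdjunction P nu hnu hE hM).unit.app A = freeUnit (hnu A) := by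
  simp only [freeAdjunction, Adjunction.mkOfHomEquiv_unit_app, Equiv.ofBijective_apply]
  rw [CategoryTheory.Functor.map_id]
  exact Category.comp_id _

end Adjunction

/-! ### From free algebras to final coalgebras -/

section Free

variable {C : Type u} [Category.{v} C] [HasBinaryCoproducts C] {P : C ⥤ Monad C} {A : C}

/-- The morphism `A # F ⟶ F` given by an algebra `F` and a morphism `η : A ⟶ F`. -/
def tau (F : IterAlg P) (η : A ⟶ F.carrier) : sharp P A F.carrier ⟶ F.carrier :=
  sharpMap P η (𝟙 _) ≫ F.str

/-- The iteration operator on `A # F`. -/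
def sharpIter (F : IterAlg P) (η : A ⟶ F.carrier) {X : C}
    (e : X ⟶ sharp P (sharp P A F.carrier) X) : X ⟶ sharp P A F.carrier :=
  e ≫ sharpMap P (𝟙 _) (F.iter (e ≫ sharpMap P (tau F η) (𝟙 X))) ≫ mult P A F.carrier

/-- The algebra `A # F`. -/
def sharpAlg (F : IterAlg P) (η : A ⟶ F.carrier) : IterAlg P where
  carrier := sharp P A F.carrier
  str := sharpMap P (𝟙 _) (tau F η) ≫ mult P A F.carrier
  iter e := sharpIter F η e

variable {F : IterAlg P} (hF : F.IsCompleteElgot) (η : A ⟶ F.carrier)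

include hF

theorem unit_tau : unit P A F.carrier ≫ tau F η = η := by
  rw [tau, unit_sharpMap_assoc, hF.unit_str, Category.comp_id]

theorem mult_tau : mult P A F.carrier ≫ tau F η =
    sharpMap P (tau F η) (𝟙 _) ≫ F.str := by
  rw [tau, mult_sharpMap_assoc, ← hF.mult_str, sharpMap_sharpMap_assoc, Category.comp_id]

/-- Under `tau` the multiplication becomes `F.str`, which leaves the solution equation in `F`. -/
theorem sharpIter_tau {X : C} (e : X ⟶ sharp P (sharp P A F.carrier) X) :
    sharpIter F η e ≫ tau F η = F.iter (e ≫ sharpMap P (tau F η) (𝟙 X)) := by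
  conv_rhs => rw [hF.solution]
  rw [sharpIter, Category.assoc, Category.assoc, mult_tau hF]
  simp [sharpMap_sharpMap_assoc]

/-- `sharpIter` unfolds once an iterate computed in `F` after applying `tau`, so the iteration
axioms are inherited from `F`. -/
theorem sharpAlg_isCompleteElgot : (sharpAlg F η).IsCompleteElgot where
  unit_str := by
    dsimp only [sharpAlg]
    rw [unit_sharpMap_assoc, Category.id_comp, unit_mult]
  mult_str := by
    dsimp only [sharpAlg]
    simp only [sharpMap_sharpMap_assoc, mult_sharpMap_assoc, mult_mult,
      Category.comp_id, Category.id_comp]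
  solution {X} e := by
    dsimp only [sharpAlg] at e ⊢
    rw [sharpMap_sharpMap_assoc, sharpIter_tau hF, Category.id_comp, sharpIter]
  functoriality {X Y} e f k hk := by
    dsimp only [sharpAlg] at e f hk ⊢
    have := hF.functoriality (e ≫ sharpMap P (tau F η) (𝟙 X)) (f ≫ sharpMap P (tau F η) (𝟙 Y)) k
      (by simp [reassoc_of% hk, sharpMap_sharpMap])
    rw [sharpIter, reassoc_of% hk, sharpMap_sharpMap_assoc, this, Category.comp_id, sharpIter]
  compositionality {X Y} f g := by
    dsimp only [sharpAlg] at f ⊢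
    have hl := hF.inl_iter (f ≫ sharpMap P (tau F η) (𝟙 Y)) g
    have hr := hF.compositionality (f ≫ sharpMap P (tau F η) (𝟙 Y)) g
    rw [blackSquare_sharpMap] at hl hr
    conv_rhs => rw [sharpIter]
    simp only [Category.assoc, sharpMap_sharpMap, sharpMap_sharpMap_assoc, sharpIter_tau hF,
      Category.comp_id, Category.id_comp, ← hr]
    rw [sharpIter, ← Category.assoc (blackSquare P f g), ← Category.assoc,
      inr_blackSquare_sharpMap, hl]
    simp only [Category.assoc, mult_mult, sharpMap_sharpMap_assoc, Category.comp_id]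
    rw [sharpIter]

/-- As in Lambek's lemma: `o` commutes with the structures, so `tau ≫ o` becomes `(u # (o ≫ tau)) ≫
m`, where `hot` and the unit law leave the identity. -/
theorem IsElgotHom.tau_comp {o : F.carrier ⟶ sharp P A F.carrier}
    (ho : IsElgotHom F (sharpAlg F η) o) (hη : η ≫ o = unit P A F.carrier)
    (hot : o ≫ tau F η = 𝟙 _) : tau F η ≫ o = 𝟙 _ := by
  have h1 : F.str ≫ o = sharpMap P o o ≫ sharpMap P (𝟙 _) (tau F η) ≫ mult P A F.carrier :=
    ho.str_comp hF (sharpAlg_isCompleteElgot hF η)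
  have h2 := sharpMap_unit_mult P (𝟙 A) (𝟙 F.carrier)
  rw [Category.id_comp] at h2
  rw [tau, Category.assoc, h1]
  simp only [sharpMap_sharpMap_assoc, hη, hot, Category.comp_id, h2, sharpMap_id]

omit hF in
/-- The carrier of a free complete Elgot algebra on `A` is a final coalgebra of `A # (-)`. -/
theorem IsFreeOn.hasTerminal {F : CompleteElgotAlg P} {η : A ⟶ F.carrier} (hF : IsFreeOn F η) :
    HasTerminal (Endofunctor.Coalgebra (sharpFunctor P A)) := by
  have hE := F.isCompleteElgot
  have endo (j : F.carrier ⟶ F.carrier) (hj : IsElgotHom F.toIterAlg F.toIterAlg j)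
      (hη : η ≫ j = η) : j = 𝟙 _ :=
    congrArg CompleteElgotAlg.Hom.hom
      ((hF F η).unique (y₁ := ⟨j, hj⟩) (y₂ := 𝟙 F) hη (Category.comp_id η))
  obtain ⟨⟨o, ho⟩, hηo, -⟩ :=
    hF ⟨sharpAlg F.toIterAlg η, sharpAlg_isCompleteElgot hE η⟩ (unit P A F.carrier)
  change F.carrier ⟶ sharp P A F.carrier at o
  change η ≫ o = unit P A F.carrier at hηo
  have hot : o ≫ tau F.toIterAlg η = 𝟙 _ := by
    -- The composite preserves iteration, by `sharpIter_tau`, and fixes `η`.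
    refine endo _ (fun e => ?_) (by rw [reassoc_of% hηo, unit_tau hE])
    have h1 : sharpIter F.toIterAlg η (e ≫ sharpMap P o (𝟙 _)) = F.iter e ≫ o := ho e
    rw [← Category.assoc, ← h1, sharpIter_tau hE, Category.assoc, sharpMap_sharpMap,
      Category.comp_id]
  have hto : tau F.toIterAlg η ≫ o = 𝟙 _ := ho.tau_comp hE η hηo hot
  -- Since `tau ≫ o = 𝟙`, solutions in `F` of `c ≫ (η # 𝟙)` are coalgebra morphisms to `(F, o)`.
  have hcoalg {X : C} (c : X ⟶ sharp P A X) (k : X ⟶ F.carrier)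
      (hk : k = c ≫ sharpMap P η k ≫ F.str) : c ≫ sharpMap P (𝟙 A) k = k ≫ o := by
    have : sharpMap P η k ≫ F.str = sharpMap P (𝟙 A) k ≫ tau F.toIterAlg η := by
      rw [tau, sharpMap_sharpMap_assoc, Category.id_comp, Category.comp_id]
    conv_rhs => rw [hk, this, Category.assoc, Category.assoc, hto, Category.comp_id]
  have hiter {X : C} (c : X ⟶ sharp P A X) :
      F.iter (c ≫ sharpMap P η (𝟙 X)) =
        c ≫ sharpMap P η (F.iter (c ≫ sharpMap P η (𝟙 X))) ≫ F.str := by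
    conv_lhs => rw [hE.solution]
    rw [Category.assoc, sharpMap_sharpMap_assoc, Category.comp_id, Category.id_comp]
  have hstr : F.str ≫ o = sharpMap P o (𝟙 _) ≫ mult P A F.carrier := by
    have h1 : F.str ≫ o = sharpMap P o o ≫ sharpMap P (𝟙 _) (tau F.toIterAlg η) ≫
        mult P A F.carrier := ho.str_comp hE (sharpAlg_isCompleteElgot hE η)
    rw [h1, sharpMap_sharpMap_assoc, Category.comp_id, hot]
  have hid : F.iter (o ≫ sharpMap P η (𝟙 _)) = 𝟙 _ := by
    apply endo
    · apply isElgotHom_iter hE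
      intro X e
      conv_lhs => rw [hE.solution]
      simp only [Category.assoc, reassoc_of% hstr, mult_sharpMap, sharpMap_sharpMap_assoc,
        Category.id_comp, Category.comp_id]
    · rw [hiter, reassoc_of% hηo, unit_sharpMap_assoc, hE.unit_str, Category.comp_id]
  let T : Endofunctor.Coalgebra (sharpFunctor P A) := ⟨F.carrier, o⟩
  refine IsTerminal.hasTerminal (X := T) (IsTerminal.ofUniqueHom
    (fun c => ⟨F.iter (X := c.V) (out c ≫ sharpMap P η (𝟙 c.V)), hcoalg (out c) _ (hiter _)⟩)
    fun c k => ?_)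
  ext
  have hk : k.f ≫ o = out c ≫ sharpMap P (𝟙 A) k.f := k.h.symm
  -- Functoriality along the coalgebra morphism `k` expresses the iterate of `c` as `k` followed by
  -- the iterate of `o`, which is the identity by `hid`.
  have h1 := hE.functoriality (out c ≫ sharpMap P η (𝟙 c.V)) (o ≫ sharpMap P η (𝟙 _)) k.f
    (by
      rw [reassoc_of% hk, Category.assoc, sharpMap_sharpMap, sharpMap_sharpMap, Category.comp_id,
        Category.id_comp, Category.comp_id, Category.id_comp])
  rw [hid] at h1
  exact (Category.comp_id _).symm.trans h1

end Free

end ElgotAlg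

theorem mainTheorem5 {C : Type u} [Category.{v} C] [HasFiniteCoproducts C] (P : C ⥤ Monad C) :
    ((∀ A : C, ∃ (F : ElgotAlg.CompleteElgotAlg P) (η : A ⟶ F.carrier), ElgotAlg.IsFreeOn F η) ↔
      ∀ A : C, HasTerminal (Endofunctor.Coalgebra (ElgotAlg.sharpFunctor P A))) ∧
    ∀ (nu : ∀ A : C, Endofunctor.Coalgebra (ElgotAlg.sharpFunctor P A))
      (hnu : ∀ A : C, IsTerminal (nu A)),
      ∃ (hE : ∀ A : C, (ElgotAlg.freeData (hnu A)).IsCompleteElgot)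
        (hM : ∀ (A B : C) (f : A ⟶ B), ElgotAlg.IsElgotHom (ElgotAlg.freeData (hnu A))
          (ElgotAlg.freeData (hnu B)) (ElgotAlg.nuMap (nu A) (hnu B) f)),
        (∀ A : C, ElgotAlg.IsFreeOn (⟨ElgotAlg.freeData (hnu A), hE A⟩ :
          ElgotAlg.CompleteElgotAlg P) (ElgotAlg.freeUnit (hnu A))) ∧
        ∃ adj : ElgotAlg.freeFunctor P nu hnu hE hM ⊣ ElgotAlg.forget P,
          ∀ A : C, adj.unit.app A = ElgotAlg.freeUnit (hnu A) := by
  refine ⟨⟨fun H A => ?_, fun H A => ?_⟩, fun nu hnu => ?_⟩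
  · obtain ⟨F, η, hF⟩ := H A
    exact hF.hasTerminal
  · have := H A
    exact ⟨_, _, ElgotAlg.freeData_isFreeOn
      (terminalIsTerminal (C := Endofunctor.Coalgebra (ElgotAlg.sharpFunctor P A)))⟩
  · exact ⟨fun A => ElgotAlg.freeData_isCompleteElgot (hnu A),
      fun A B f => ElgotAlg.nuMap_isElgotHom (hnu A) (hnu B) f,
      fun A => ElgotAlg.freeData_isFreeOn (hnu A),
      ElgotAlg.freeAdjunction P nu hnu _ _, ElgotAlg.freeAdjunction_unit P nu hnu _ _⟩
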